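/- Let $\mathcal{V}=(\mathcal{V},\otimes,k)$ be a commutative unital quantale with internal hom $\multimap$, and let $\mathcal{T}=(\mathbb{T},\mathcal{V},\xi)$ be a strict topological theory with $T1=1$. That is, $\mathbb{T}=(T,e,m)$ is a monad on $\mathbf{Set}$ such that $T$ sends pullbacks to weak pullbacks and every naturality square of $m$ is a weak pullback; and $\xi:T\mathcal{V}\to\mathcal{V}$ is a $\mathbb{T}$-algebra structure ($\xi e_{\mathcal V}=1$, $\xi\cdot T\xi=\xi\cdot m_{\mathcal V}$) for which $\otimes:\mathcal V\times\mathcal V\to\mathcal V$ and $k:1\to\mathcal V$ are algebra homomorphisms and $\varphi\mapsto\xi\cdot T\varphi$ is a natural transformation $P_{\mathcal V}\to P_{\mathcal V}T$ of functors $\mathbf{Set}\to\mathbf{Ord}$, where $P_{\mathcal V}X=\mathcal V^X$ and $P_{\mathcal V}f(\varphi)(y)=\bigvee_{f(x)=y}\varphi(x)$. For $r:X\times Y\to\mathcal V$ let $T_\xi r(\mathfrak x,\mathfrak y)=\bigvee\{\xi(Tr(\mathfrak w))\mid \mathfrak w\in T(X\times Y),\,T\pi_1(\mathfrak w)=\mathfrak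 x,\,T\pi_2(\mathfrak w)=\mathfrak y\}$. A $\mathcal T$-relation $a$ from $X$ to $Y$ is a map $a:TX\times Y\to\mathcal V$; for a $\mathcal T$-relation $b$ from $Y$ to $Z$ put $(b\circ a)(\mathfrak x,z)=\bigvee_{m_X(\mathfrak X)=\mathfrak x}\bigvee_{\mathfrak y\in TY}T_\xi a(\mathfrak X,\mathfrak y)\otimes b(\mathfrak y,z)$. $\mathcal T$-relations are ordered pointwise. A $\mathcal T$-category $(X,a)$ is a set $X$ with a $\mathcal T$-relation $a$ from $X$ to $X$ such that $k\le a(e_X(x),x)$ and $T_\xi a(\mathfrak X,\mathfrak x)\otimes a(\mathfrak x,x)\le a(m_X(\mathfrak X),x)$. A $\mathcal T$-functor $f:(X,a)\to(Y,b)$ is a map with $a(\mathfrak x,x)\le b(Tf(\mathfrak x),f(x))$; it induces $f_*(\mathfrak x,y)=b(Tf(\mathfrak x),y)$ and $f^*(\mathfrak y,x)=b(\mathfrak y,f(x))$, and $f\cong g$ means $f^*=g^*$. A $\mathcal T$-module $\varphi:(X,a)\to(Y,b)$ is a $\mathcal T$-relation with $\varphi\circ a\le\varphi$ and $b\circ\varphi\le\varphi$;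 $\mathcal T$-modules $\varphi:(Z,c)\to(X,a)$, $\psi:(X,a)\to(Z,c)$ are adjoint, $\varphi\dashv\psi$, if $c\le\psi\circ\varphi$ and $\varphi\circ\psi\le a$. A $\mathcal T$-functor $f:(X,a)\to(Y,b)$ is fully faithful if $a(\mathfrak x,x)=b(Tf(\mathfrak x),f(x))$ for all $\mathfrak x\in TX$, $x\in X$, and L-dense if $f_*\circ f^*=b$. A $\mathcal T$-category $X$ is L-complete if every adjunction $\varphi\dashv\psi$ of $\mathcal T$-modules $\varphi:Z\to X$, $\psi:X\to Z$ ($Z$ any $\mathcal T$-category) is of the form $f_*\dashv f^*$ for a $\mathcal T$-functor $f:Z\to X$. It is L-injective if for every fully faithful L-dense $\mathcal T$-functor $i:A\to B$ and every $\mathcal T$-functor $f:A\to X$ there is a $\mathcal T$-functor $g:B\to X$ with $g\cdot i\cong f$. Regard $\mathcal V$ as a $\mathcal T$-category via $(\mathfrak v,v)\mapsto \xi(\mathfrak v)\multimap v$, and let $|X|=(TX,m_X)$, where $m_X$ is regarded as a $\mathcal V$-relation. Let $X^{\mathrm{op}}$ be $TX$ with the structure $(\mathfrak X,\mathfrak x)\mapsto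 T_\xi(r^\circ)(\mathfrak X,e_{TX}(\mathfrak x))$, where $r(\mathfrak x,\mathfrak y)=\bigvee_{m_X(\mathfrak X)=\mathfrak x}T_\xi a(\mathfrak X,\mathfrak y)$ and $r^\circ(\mathfrak y,\mathfrak x)=r(\mathfrak x,\mathfrak y)$. The exponential $|X|\multimap\mathcal V$ is the set of $\mathcal T$-functors $|X|\to\mathcal V$ with the structure $$(\mathfrak p,h)\mapsto\bigwedge_{\substack{\mathfrak q\in T(TX\times(|X|\multimap\mathcal V)),\ T\pi_2(\mathfrak q)=\mathfrak p\\ \mathfrak x\in TX}}m_X(T\pi_1(\mathfrak q),\mathfrak x)\multimap\bigl(\xi(T\mathrm{ev}(\mathfrak q))\multimap h(\mathfrak x)\bigr).$$ Let $\tilde X$ be its full subcategory of all $\psi$ such that $\psi:X^{\mathrm{op}}\to\mathcal V$ is also a $\mathcal T$-functor and $\psi$, regarded as a $\mathcal T$-module from $X$ to the $\mathcal T$-category $E=(1,k)$, has a left adjoint. Let $y:X\to\tilde X$, $x\mapsto a(-,x)$, be the Yoneda functor. **Theorem.** For every $\mathcal T$-category $X=(X,a)$ the following are equivalent: 1. $X$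 is L-complete; 2. $X$ is L-injective; 3. $y:X\to\tilde X$ has a pseudo left inverse: there is a $\mathcal T$-functor $R:\tilde X\to X$ with $R\cdot y\cong 1_X$. -/

import Mathlib

universe u

open scoped Quantale

/-! ### Set monads, elementwise -/

namespace SetMonad

variable (M : CategoryTheory.Monad (Type u))

/-- The action of `T` on functions. -/
def map {X Y : Type u} (f : X → Y) (t : M.obj X) : M.obj Y := M.map (TypeCat.ofHom f) t

/-- The unit `e_X : X → TX`. -/
def e {X : Type u} (x : X) : M.obj X := M.η.app X x

/-- The multiplication `m_X : TTX → TX`. -/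
def mu {X : Type u} (t : M.obj (M.obj X)) : M.obj X := M.μ.app X t

theorem map_id {X : Type u} (t : M.obj X) : map M (fun x => x) t = t := by
  have := M.toFunctor.map_id X
  exact congrArg (fun h : M.obj X ⟶ M.obj X => h t) this

theorem map_map {X Y Z : Type u} (f : X → Y) (g : Y → Z) (t : M.obj X) :
    map M g (map M f t) = map M (fun x => g (f x)) t := by
  have := M.toFunctor.map_comp (TypeCat.ofHom f) (TypeCat.ofHom g)
  exact (congrArg (fun h : M.obj X ⟶ M.obj Z => h t) this).symm

theorem map_e {X Y : Type u} (f : X → Y) (x : X) : map M f (e M x) = e M (f x) := by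
  have := M.η.naturality (TypeCat.ofHom f)
  exact (congrArg (fun h : X ⟶ M.obj Y => h x) this).symm

theorem map_mu {X Y : Type u} (f : X → Y) (t : M.obj (M.obj X)) :
    map M f (mu M t) = mu M (map M (map M f) t) := by
  have := M.μ.naturality (TypeCat.ofHom f)
  exact (congrArg (fun h : M.obj (M.obj X) ⟶ M.obj Y => h t) this).symm

theorem mu_e {X : Type u} (t : M.obj X) : mu M (e M t) = t := by
  have := M.left_unit X
  exact congrArg (fun h : M.obj X ⟶ M.obj X => h t) this

theorem mu_map_e {X : Type u} (t : M.obj X) : mu M (map M (e M) t) = t := by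
  have := M.right_unit X
  exact congrArg (fun h : M.obj X ⟶ M.obj X => h t) this

theorem mu_mu {X : Type u} (t : M.obj (M.obj (M.obj X))) :
    mu M (map M (mu M) t) = mu M (mu M t) := by
  have := M.assoc X
  exact congrArg (fun h : M.obj (M.obj (M.obj X)) ⟶ M.obj X => h t) this

end SetMonad

/-- The square `f ∘ p = g ∘ q` is a pullback of sets. -/
def IsPullbackSquare {P X Y Z : Type u} (p : P → X) (q : P → Y) (f : X → Z) (g : Y → Z) : Prop :=
  (∀ w, f (p w) = g (q w)) ∧ ∀ x y, f x = g y → ∃! w, p w = x ∧ q w = y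

/-- The square `f ∘ p = g ∘ q` is a weak pullback of sets. -/
def IsWeakPullbackSquare {P X Y Z : Type u} (p : P → X) (q : P → Y) (f : X → Z) (g : Y → Z) :
    Prop :=
  (∀ w, f (p w) = g (q w)) ∧ ∀ x y, f x = g y → ∃ w, p w = x ∧ q w = y

/-! ### Strict topological theories

`V` is a commutative unital quantale: `*` is the tensor, `1` is the neutral element `k`, and
`u ⇨ₗ v` is the internal hom, `z ≤ u ⇨ₗ v ↔ z * u ≤ v`. -/

/-- A strict topological theory `(T, V, ξ)` with `T1 = 1`. -/
structure TopTheory (V : Type u) [CommMonoid V] [CompleteLattice V] [IsQuantale V] where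
  /-- the monad `(T, e, m)` on sets -/
  monad : CategoryTheory.Monad (Type u)
  /-- the map `ξ : TV → V` -/
  xi : monad.obj V → V
  /-- `T` sends pullbacks to weak pullbacks -/
  map_weakPullback : ∀ {P X Y Z : Type u} (p : P → X) (q : P → Y) (f : X → Z) (g : Y → Z),
    IsPullbackSquare p q f g →
      IsWeakPullbackSquare (SetMonad.map monad p) (SetMonad.map monad q)
        (SetMonad.map monad f) (SetMonad.map monad g)
  /-- the naturality squares of `m` are weak pullbacks -/
  mu_weakPullback : ∀ {X Y : Type u} (f : X → Y),
    IsWeakPullbackSquare (SetMonad.map monad (SetMonad.map monad f)) (SetMonad.mu monad (X := X))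
      (SetMonad.mu monad (X := Y)) (SetMonad.map monad f)
  /-- `ξ · e_V = 1_V` -/
  xi_e : ∀ v : V, xi (SetMonad.e monad v) = v
  /-- `ξ · Tξ = ξ · m_V` -/
  xi_mu : ∀ t : monad.obj (monad.obj V), xi (SetMonad.map monad xi t) = xi (SetMonad.mu monad t)
  /-- compatibility of `ξ` with the tensor -/
  xi_mul : ∀ t : monad.obj (V × V), xi (SetMonad.map monad (fun p => p.1 * p.2) t) =
    xi (SetMonad.map monad Prod.fst t) * xi (SetMonad.map monad Prod.snd t)
  /-- compatibility of `ξ` with `k : 1 → V` -/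
  xi_one : ∀ t : monad.obj PUnit.{u + 1}, xi (SetMonad.map monad (fun _ => (1 : V)) t) = 1
  /-- `ξ_X : V^X → V^(TX)`, `φ ↦ ξ · Tφ`, is monotone -/
  xi_mono : ∀ {X : Type u} (φ φ' : X → V), (∀ x, φ x ≤ φ' x) →
    ∀ t : monad.obj X, xi (SetMonad.map monad φ t) ≤ xi (SetMonad.map monad φ' t)
  /-- `(ξ_X)_X` is natural, from the `V`-powerset functor `P_V` to `P_V T` -/
  xi_natural : ∀ {X Y : Type u} (f : X → Y) (φ : X → V) (s : monad.obj Y),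
    xi (SetMonad.map monad (fun y => ⨆ x, ⨆ _ : f x = y, φ x) s) =
      ⨆ t, ⨆ _ : SetMonad.map monad f t = s, xi (SetMonad.map monad φ t)
  /-- `T1 = 1` -/
  obj_one : ∀ s t : monad.obj PUnit.{u + 1}, s = t

namespace TopTheory

variable {V : Type u} [CommMonoid V] [CompleteLattice V] [IsQuantale V] (Θ : TopTheory V)

/-- The set `TX`. -/
abbrev T (X : Type u) : Type u := Θ.monad.obj X

/-- The map `Tf : TX → TY`. -/
def map {X Y : Type u} (f : X → Y) : Θ.T X → Θ.T Y := SetMonad.map Θ.monad f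

/-- The unit `e_X : X → TX`. -/
def e {X : Type u} : X → Θ.T X := SetMonad.e Θ.monad

/-- The multiplication `m_X : TTX → TX`. -/
def mu {X : Type u} : Θ.T (Θ.T X) → Θ.T X := SetMonad.mu Θ.monad

theorem map_id {X : Type u} (t : Θ.T X) : Θ.map (fun x => x) t = t := SetMonad.map_id _ t

theorem map_map {X Y Z : Type u} (f : X → Y) (g : Y → Z) (t : Θ.T X) :
    Θ.map g (Θ.map f t) = Θ.map (fun x => g (f x)) t := SetMonad.map_map _ f g t

theorem map_e {X Y : Type u} (f : X → Y) (x : X) : Θ.map f (Θ.e x) = Θ.e (f x) :=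
  SetMonad.map_e _ f x

theorem map_mu {X Y : Type u} (f : X → Y) (t : Θ.T (Θ.T X)) :
    Θ.map f (Θ.mu t) = Θ.mu (Θ.map (Θ.map f) t) := SetMonad.map_mu _ f t

theorem mu_e {X : Type u} (t : Θ.T X) : Θ.mu (Θ.e t) = t := SetMonad.mu_e _ t

theorem mu_map_e {X : Type u} (t : Θ.T X) : Θ.mu (Θ.map Θ.e t) = t := SetMonad.mu_map_e _ t

theorem mu_mu {X : Type u} (t : Θ.T (Θ.T (Θ.T X))) : Θ.mu (Θ.map Θ.mu t) = Θ.mu (Θ.mu t) :=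
  SetMonad.mu_mu _ t

theorem exists_of_isPullbackSquare {P X Y Z : Type u} {p : P → X} {q : P → Y} {f : X → Z}
    {g : Y → Z} (h : IsPullbackSquare p q f g) (s : Θ.T X) (t : Θ.T Y)
    (hst : Θ.map f s = Θ.map g t) : ∃ w : Θ.T P, Θ.map p w = s ∧ Θ.map q w = t :=
  (Θ.map_weakPullback p q f g h).2 s t hst

theorem exists_of_mu {X Y : Type u} (f : X → Y) (S : Θ.T (Θ.T Y)) (t : Θ.T X)
    (h : Θ.mu S = Θ.map f t) : ∃ W : Θ.T (Θ.T X), Θ.map (Θ.map f) W = S ∧ Θ.mu W = t :=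
  (Θ.mu_weakPullback f).2 S t h

theorem xi_of_e (v : V) : Θ.xi (Θ.e v) = v := Θ.xi_e v

theorem xi_map_xi (t : Θ.T (Θ.T V)) : Θ.xi (Θ.map Θ.xi t) = Θ.xi (Θ.mu t) := Θ.xi_mu t

theorem xi_map_mul (t : Θ.T (V × V)) : Θ.xi (Θ.map (fun p => p.1 * p.2) t) =
    Θ.xi (Θ.map Prod.fst t) * Θ.xi (Θ.map Prod.snd t) := Θ.xi_mul t

theorem xi_map_one (t : Θ.T PUnit.{u + 1}) : Θ.xi (Θ.map (fun _ => (1 : V)) t) = 1 := Θ.xi_one t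

theorem xi_map_mono {X : Type u} {φ φ' : X → V} (h : ∀ x, φ x ≤ φ' x) (t : Θ.T X) :
    Θ.xi (Θ.map φ t) ≤ Θ.xi (Θ.map φ' t) := Θ.xi_mono φ φ' h t

/-- The extension `T_ξ r : TX ⇸ TY` of a `V`-relation `r : X ⇸ Y`. -/
def ext {X Y : Type u} (r : X → Y → V) (s : Θ.T X) (t : Θ.T Y) : V :=
  ⨆ w : Θ.T (X × Y), ⨆ _ : Θ.map Prod.fst w = s, ⨆ _ : Θ.map Prod.snd w = t,
    Θ.xi (Θ.map (fun p => r p.1 p.2) w)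

/-- A `T`-relation from `X` to `Y` is a `V`-relation from `TX` to `Y`. -/
abbrev TRel (X Y : Type u) : Type u := Θ.T X → Y → V

variable {Θ}

/-- The Kleisli convolution `b ∘ a = b · T_ξ a · m_X°`. -/
def kleisli {X Y Z : Type u} (b : Θ.TRel Y Z) (a : Θ.TRel X Y) : Θ.TRel X Z :=
  fun s z => ⨆ S : Θ.T (Θ.T X), ⨆ _ : Θ.mu S = s, ⨆ t : Θ.T Y, Θ.ext a S t * b t z

/-- `f : (X, a) → (Y, b)` satisfies the `T`-functor condition `f · a ≤ b · Tf`. -/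
def IsTFunctor {X Y : Type u} (a : Θ.TRel X X) (b : Θ.TRel Y Y) (f : X → Y) : Prop :=
  ∀ s x, a s x ≤ b (Θ.map f s) (f x)

/-- `φ : (X, a) ⇸ (Y, b)` is a `T`-module. -/
def IsTModule {X Y : Type u} (a : Θ.TRel X X) (b : Θ.TRel Y Y) (φ : Θ.TRel X Y) : Prop :=
  kleisli φ a ≤ φ ∧ kleisli b φ ≤ φ

/-- The adjunction `φ ⊣ ψ` of `T`-modules `φ : (Z, c) ⇸ (X, a)` and `ψ : (X, a) ⇸ (Z, c)`. -/
def IsAdjunction {Z X : Type u} (c : Θ.TRel Z Z) (a : Θ.TRel X X)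
    (φ : Θ.TRel Z X) (ψ : Θ.TRel X Z) : Prop :=
  IsTModule c a φ ∧ IsTModule a c ψ ∧ c ≤ kleisli ψ φ ∧ kleisli φ ψ ≤ a

variable (Θ)

/-- The structure `hom_ξ` of the `T`-category `V`. -/
def homXi : Θ.TRel V V := fun t v => Θ.xi t ⇨ₗ v

/-- The structure of the `T`-category `|X| = (TX, m_X)`: the map `m_X` as a `V`-relation. -/
def freeStr (X : Type u) : Θ.TRel (Θ.T X) (Θ.T X) := fun S s => ⨆ _ : Θ.mu S = s, (1 : V)

variable {Θ}

/-- The structure `T_ξ a · m_X°` of the `V`-category `M(X)`, with underlying set `TX`. -/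
def mStr {X : Type u} (a : Θ.TRel X X) : Θ.T X → Θ.T X → V :=
  fun s t => ⨆ S : Θ.T (Θ.T X), ⨆ _ : Θ.mu S = s, Θ.ext a S t

/-- The structure `e° · T_ξ (r°)` of the dual `X^op = A(M(X)^op)`, where `r` is the structure
of `M(X)`; the underlying set is `TX`. -/
def opStr {X : Type u} (a : Θ.TRel X X) : Θ.TRel (Θ.T X) (Θ.T X) :=
  fun S s => Θ.ext (fun t t' => mStr a t' t) S (Θ.e s)

/-- The set of `T`-functors from `(X, a)` to `(Y, b)`, underlying the exponential. -/
abbrev FunSp {X Y : Type u} (a : Θ.TRel X X) (b : Θ.TRel Y Y) : Type u :=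
  {f : X → Y // IsTFunctor a b f}

/-- The structure of the exponential `(X, a) ⊸ (Y, b)`, where `Y` is the `T`-category `V`
or, more generally, any set with a `T`-relation. -/
def funStr {X Y : Type u} (a : Θ.TRel X X) (b : Θ.TRel Y Y) :
    Θ.TRel (FunSp a b) (FunSp a b) :=
  fun p h => ⨅ q : Θ.T (X × FunSp a b), ⨅ _ : Θ.map Prod.snd q = p, ⨅ x : X,
    a (Θ.map Prod.fst q) x ⇨ₗ b (Θ.map (fun z => z.2.1 z.1) q) (h.1 x)

/-- The structure induced on `A` by a map `i : A → X` (for an inclusion: the full subcategory). -/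
def restrictStr {A X : Type u} (i : A → X) (a : Θ.TRel X X) : Θ.TRel A A :=
  fun s y => a (Θ.map i s) (i y)

/-! ### Facts about the extension of relations -/

theorem le_ext {X Y : Type u} (r : X → Y → V) (w : Θ.T (X × Y)) {s : Θ.T X} {t : Θ.T Y}
    (hs : Θ.map Prod.fst w = s) (ht : Θ.map Prod.snd w = t) :
    Θ.xi (Θ.map (fun p => r p.1 p.2) w) ≤ Θ.ext r s t :=
  le_iSup_of_le w (le_iSup_of_le hs (le_iSup_of_le ht le_rfl))

theorem ext_le {X Y : Type u} {r : X → Y → V} {s : Θ.T X} {t : Θ.T Y} {v : V}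
    (h : ∀ w : Θ.T (X × Y), Θ.map Prod.fst w = s → Θ.map Prod.snd w = t →
      Θ.xi (Θ.map (fun p => r p.1 p.2) w) ≤ v) : Θ.ext r s t ≤ v :=
  iSup_le fun w => iSup_le fun hs => iSup_le fun ht => h w hs ht

theorem ext_mul_le {X Y : Type u} {r : X → Y → V} {s : Θ.T X} {t : Θ.T Y} {u v : V}
    (h : ∀ w : Θ.T (X × Y), Θ.map Prod.fst w = s → Θ.map Prod.snd w = t →
      Θ.xi (Θ.map (fun p => r p.1 p.2) w) * u ≤ v) : Θ.ext r s t * u ≤ v := by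
  rw [← Quantale.leftMulResiduation_le_iff_mul_le]
  exact ext_le fun w hs ht => Quantale.leftMulResiduation_le_iff_mul_le.2 (h w hs ht)

theorem map_const (Θ : TopTheory V) {X Y : Type u} (y : Y) (t : Θ.T X) :
    Θ.map (fun _ => y) t = Θ.e y := by
  have h : Θ.map (fun _ : PUnit.{u + 1} => y) (Θ.map (fun _ : X => PUnit.unit) t) =
      Θ.map (fun _ => y) (Θ.e PUnit.unit) := congrArg _ (Θ.obj_one _ _)
  rw [TopTheory.map_map, TopTheory.map_e] at h
  exact h

theorem xi_mul' (Θ : TopTheory V) {X : Type u} (φ φ' : X → V) (t : Θ.T X) :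
    Θ.xi (Θ.map (fun x => φ x * φ' x) t) = Θ.xi (Θ.map φ t) * Θ.xi (Θ.map φ' t) := by
  have h := Θ.xi_map_mul (Θ.map (fun x => (φ x, φ' x)) t)
  simp only [TopTheory.map_map] at h
  exact h

theorem ext_comap_le {A B X Y : Type u} (f : A → X) (g : B → Y) (r : X → Y → V) (s : Θ.T A)
    (t : Θ.T B) : Θ.ext (fun x y => r (f x) (g y)) s t ≤ Θ.ext r (Θ.map f s) (Θ.map g t) := by
  refine ext_le fun w hs ht => ?_
  have h := le_ext (Θ := Θ) r (Θ.map (fun p : A × B => (f p.1, g p.2)) w)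
    (s := Θ.map f s) (t := Θ.map g t)
    (by rw [← hs]; simp only [TopTheory.map_map]) (by rw [← ht]; simp only [TopTheory.map_map])
  simp only [TopTheory.map_map] at h
  exact h

theorem le_ext_e {X Y : Type u} (r : X → Y → V) (x : X) (y : Y) :
    r x y ≤ Θ.ext r (Θ.e x) (Θ.e y) := by
  have h := le_ext (Θ := Θ) r (Θ.e (x, y)) (TopTheory.map_e _ _ _) (TopTheory.map_e _ _ _)
  rwa [TopTheory.map_e, Θ.xi_of_e] at h

theorem kleisli_le {X Y Z : Type u} {b : Θ.TRel Y Z} {a : Θ.TRel X Y} {c : Θ.TRel X Z}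
    (h : ∀ S t z, Θ.ext a S t * b t z ≤ c (Θ.mu S) z) : kleisli b a ≤ c := by
  intro s z
  refine iSup_le fun S => iSup_le fun hS => iSup_le fun t => ?_
  subst hS
  exact h S t z

end TopTheory

open TopTheory in
/-- A `T`-category `(X, a)`. -/
structure TCat {V : Type u} [CommMonoid V] [CompleteLattice V] [IsQuantale V]
    (Θ : TopTheory V) where
  /-- the underlying set -/
  carrier : Type u
  /-- the structure `a : TX ⇸ X` -/
  str : Θ.TRel carrier carrier
  one_le : ∀ x, 1 ≤ str (Θ.e x) x
  trans : ∀ S s x, Θ.ext str S s * str s x ≤ str (Θ.mu S) x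

namespace TCat

open TopTheory

variable {V : Type u} [CommMonoid V] [CompleteLattice V] [IsQuantale V] {Θ : TopTheory V}

/-! ### `T`-functors and the modules they induce -/

/-- A `T`-functor. -/
structure Hom (X Y : TCat Θ) where
  /-- the underlying map -/
  toFun : X.carrier → Y.carrier
  isTFunctor : IsTFunctor X.str Y.str toFun

/-- The identity `T`-functor. -/
def Hom.id (X : TCat Θ) : Hom X X where
  toFun x := x
  isTFunctor s x := by rw [TopTheory.map_id]

/-- The composite `g · f`. -/
def Hom.comp {X Y Z : TCat Θ} (g : Hom Y Z) (f : Hom X Y) : Hom X Z where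
  toFun x := g.toFun (f.toFun x)
  isTFunctor s x := by
    have h := (f.isTFunctor s x).trans (g.isTFunctor _ _)
    rwa [TopTheory.map_map] at h

/-- The module `f_* = b · Tf : X ⇸ Y`. -/
def Hom.lower {X Y : TCat Θ} (f : Hom X Y) : Θ.TRel X.carrier Y.carrier :=
  fun s y => Y.str (Θ.map f.toFun s) y

/-- The module `f^* = f° · b : Y ⇸ X`. -/
def Hom.upper {X Y : TCat Θ} (f : Hom X Y) : Θ.TRel Y.carrier X.carrier :=
  fun t x => Y.str t (f.toFun x)

/-- The equivalence `f ≅ g`, that is, `f ≤ g` and `g ≤ f` where `f ≤ g` means `f^* ≤ g^*`. -/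
def Hom.Equivalent {X Y : TCat Θ} (f g : Hom X Y) : Prop :=
  f.upper ≤ g.upper ∧ g.upper ≤ f.upper

/-- `f` is fully faithful: `a(s, x) = b(Tf(s), f(x))`, that is, `1_X^* = f^* ∘ f_*`. -/
def Hom.FullyFaithful {X Y : TCat Θ} (f : Hom X Y) : Prop :=
  ∀ s x, X.str s x = Y.str (Θ.map f.toFun s) (f.toFun x)

/-- `f` is L-dense: `f_* ∘ f^* = 1_Y^*`. -/
def Hom.LDense {X Y : TCat Θ} (f : Hom X Y) : Prop :=
  kleisli f.lower f.upper = Y.str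

/-! ### L-completeness and L-injectivity -/

/-- `X` is L-complete: every adjunction `φ ⊣ ψ` with `φ : Z ⇸ X` and `ψ : X ⇸ Z` is of the form
`f_* ⊣ f^*` for a `T`-functor `f : Z → X`. -/
def LComplete (X : TCat Θ) : Prop :=
  ∀ (Z : TCat Θ) (φ : Θ.TRel Z.carrier X.carrier) (ψ : Θ.TRel X.carrier Z.carrier),
    IsAdjunction Z.str X.str φ ψ → ∃ f : Hom Z X, φ = f.lower ∧ ψ = f.upper

/-- `Z` is L-injective: `T`-functors into `Z` extend, up to equivalence, along fully faithful
L-dense `T`-functors. -/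
def LInjective (Z : TCat Θ) : Prop :=
  ∀ (X Y : TCat Θ) (i : Hom X Y), i.FullyFaithful → i.LDense →
    ∀ f : Hom X Z, ∃ g : Hom Y Z, (g.comp i).Equivalent f

/-! ### The `T`-categories `E`, `|X| ⊸ V`, `X̂` and `X̃` -/

/-- The `T`-category `E = (1, k)`. -/
def E (Θ : TopTheory V) : TCat Θ where
  carrier := PUnit.{u + 1}
  str _ _ := 1
  one_le _ := le_rfl
  trans S s x := by
    rw [mul_one]
    refine ext_le fun w _ _ => ?_
    have h := Θ.xi_map_one (Θ.map (fun _ => PUnit.unit) w)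
    rw [TopTheory.map_map] at h
    exact h.le

/-- The full subcategory given by an injection `i : A → X` (or the initial structure for an
arbitrary map `i`). -/
def restrict (X : TCat Θ) {A : Type u} (i : A → X.carrier) : TCat Θ where
  carrier := A
  str := restrictStr i X.str
  one_le x := by
    rw [restrictStr, TopTheory.map_e]
    exact X.one_le _
  trans S s x := by
    change Θ.ext (restrictStr i X.str) S s * X.str (Θ.map i s) (i x) ≤
      X.str (Θ.map i (Θ.mu S)) (i x)
    rw [TopTheory.map_mu]
    refine le_trans (mul_le_mul_left ?_ _) (X.trans _ (Θ.map i s) _)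
    exact ext_comap_le (Θ.map i) i X.str S s

theorem isTFunctor_free_iff (X : Type u) (φ : Θ.T X → V) :
    IsTFunctor (Θ.freeStr X) Θ.homXi φ ↔ ∀ S, Θ.xi (Θ.map φ S) ≤ φ (Θ.mu S) := by
  constructor
  · intro h S
    have := h S (Θ.mu S)
    rw [freeStr, iSup_pos rfl, homXi, Quantale.leftMulResiduation_le_iff_mul_le, one_mul] at this
    exact this
  · intro h S s
    refine iSup_le fun hS => ?_
    subst hS
    rw [homXi, Quantale.leftMulResiduation_le_iff_mul_le, one_mul]
    exact h S

theorem le_funStr_iff (X : Type u) (v : V) (p : Θ.T (FunSp (Θ.freeStr X) Θ.homXi))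
    (h : FunSp (Θ.freeStr X) Θ.homXi) :
    v ≤ funStr (Θ.freeStr X) Θ.homXi p h ↔
      ∀ q : Θ.T (Θ.T X × FunSp (Θ.freeStr X) Θ.homXi), Θ.map Prod.snd q = p →
        v * Θ.xi (Θ.map (fun z => z.2.1 z.1) q) ≤ h.1 (Θ.mu (Θ.map Prod.fst q)) := by
  simp only [funStr, le_iInf_iff, Quantale.leftMulResiduation_le_iff_mul_le, homXi]
  constructor
  · intro H q hq
    have := H q hq (Θ.mu (Θ.map Prod.fst q))
    rwa [freeStr, iSup_pos rfl, mul_one] at this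
  · intro H q hq s
    rw [mul_comm v, mul_assoc, ← Quantale.leftMulResiduation_le_iff_mul_le, freeStr]
    refine iSup_le fun hs => ?_
    rw [Quantale.leftMulResiduation_le_iff_mul_le, one_mul, ← hs]
    exact H q hq

/-- The `T`-category `|X| ⊸ V`. -/
def freeExp (Θ : TopTheory V) (X : Type u) : TCat Θ where
  carrier := FunSp (Θ.freeStr X) Θ.homXi
  str := funStr (Θ.freeStr X) Θ.homXi
  one_le h := by
    rw [le_funStr_iff]
    intro q hq
    obtain ⟨S, hS, -⟩ := Θ.exists_of_isPullbackSquare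
      (p := fun s : Θ.T X => (s, h)) (q := fun _ => PUnit.unit.{u + 1}) (f := Prod.snd)
      (g := fun _ => h) ⟨fun _ => rfl, by
        rintro ⟨s, h'⟩ _ (rfl : h' = h)
        exact ⟨s, ⟨rfl, rfl⟩, fun y hy => congrArg Prod.fst hy.1⟩⟩ q (Θ.e PUnit.unit)
      (by rw [hq, TopTheory.map_e])
    rw [one_mul, ← hS, TopTheory.map_map, TopTheory.map_map,
      TopTheory.map_id]
    exact (isTFunctor_free_iff X h.1).1 h.2 S
  trans P p h := by
    refine ext_mul_le fun w hP hp => ?_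
    rw [le_funStr_iff]
    intro q hq
    obtain ⟨Q, hQ, hQq⟩ := Θ.exists_of_mu
      (Prod.snd : Θ.T X × FunSp (Θ.freeStr X) Θ.homXi → _) P q hq.symm
    obtain ⟨r, hr1, hr2⟩ := Θ.exists_of_isPullbackSquare
      (p := fun z : Θ.T (Θ.T X × FunSp (Θ.freeStr X) Θ.homXi) ×
        FunSp (Θ.freeStr X) Θ.homXi => z.1)
      (q := fun z => (Θ.map Prod.snd z.1, z.2)) (f := Θ.map Prod.snd) (g := Prod.fst)
      ⟨fun _ => rfl, by
        rintro t ⟨p', g⟩ (rfl : _ = p')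
        refine ⟨(t, g), ⟨rfl, rfl⟩, ?_⟩
        rintro ⟨t', g'⟩ ⟨h1, h2⟩
        exact Prod.ext h1 (congrArg Prod.snd h2 :)⟩ Q w (by rw [hQ, hP])
    let d : Θ.T (Θ.T X × FunSp (Θ.freeStr X) Θ.homXi) × FunSp (Θ.freeStr X) Θ.homXi →
      Θ.T X × FunSp (Θ.freeStr X) Θ.homXi := fun z => (Θ.mu (Θ.map Prod.fst z.1), z.2)
    have key := (le_funStr_iff X (funStr (Θ.freeStr X) Θ.homXi p h) p h).1 le_rfl (Θ.map d r)
      (by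
        rw [← hp, ← hr2]
        simp only [TopTheory.map_map]
        rfl)
    have hm : Θ.mu (Θ.map Prod.fst (Θ.map d r)) = Θ.mu (Θ.map Prod.fst q) := by
      have h1 : Θ.map Prod.fst (Θ.map d r) = Θ.map Θ.mu (Θ.map (Θ.map Prod.fst) Q) := by
        rw [← hr1]
        simp only [TopTheory.map_map]
        rfl
      rw [h1, TopTheory.mu_mu, ← hQq, ← TopTheory.map_mu]
    rw [hm] at key
    have hev : Θ.xi (Θ.map (fun z => z.2.1 z.1) q) = Θ.xi (Θ.map (fun z =>
        Θ.xi (Θ.map (fun z : Θ.T X × FunSp (Θ.freeStr X) Θ.homXi => z.2.1 z.1) z.1)) r) := by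
      rw [← hQq, TopTheory.map_mu, ← Θ.xi_map_xi, TopTheory.map_map, ← hr1, TopTheory.map_map]
    have hw : Θ.map (fun z => funStr (Θ.freeStr X) Θ.homXi z.1 z.2) w =
        Θ.map (fun z => funStr (Θ.freeStr X) Θ.homXi (Θ.map Prod.snd z.1) z.2) r := by
      rw [← hr2]
      simp only [TopTheory.map_map]
    rw [hw, hev, mul_assoc, mul_comm, mul_assoc, ← xi_mul']
    refine le_trans (mul_le_mul_right ?_ _) key
    simp only [TopTheory.map_map]
    refine Θ.xi_map_mono (fun z => ?_) r
    rw [mul_comm]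
    exact (le_funStr_iff X _ _ _).1 le_rfl z.1 rfl

/-- The `T`-category `X̂`: the full subcategory of `|X| ⊸ V` of all `ψ` such that
`ψ : X^op → V` is a `T`-functor as well. -/
def hat (X : TCat Θ) : TCat Θ :=
  (freeExp Θ X.carrier).restrict
    (A := {ψ : FunSp (Θ.freeStr X.carrier) Θ.homXi // IsTFunctor (opStr X.str) Θ.homXi ψ.1})
    Subtype.val

/-- An element `ψ` of `X̂`, as a `T`-relation from `X` to `E`. -/
def toRel (X : TCat Θ) (ψ : X.hat.carrier) : Θ.TRel X.carrier (E Θ).carrier :=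
  fun s _ => ψ.1.1 s

/-- `ψ ∈ X̂` is tight: as a `T`-module from `X` to `E` it is right adjoint. -/
def Tight (X : TCat Θ) (ψ : X.hat.carrier) : Prop :=
  ∃ φ : Θ.TRel (E Θ).carrier X.carrier, IsAdjunction (E Θ).str X.str φ (X.toRel ψ)

/-- The `T`-category `X̃`: the full subcategory of `X̂` of all tight elements. -/
def tilde (X : TCat Θ) : TCat Θ :=
  X.hat.restrict (A := {ψ : X.hat.carrier // X.Tight ψ}) Subtype.val

/-! ### The Yoneda functor -/

theorem ext_const_le (X : TCat Θ) (S : Θ.T (Θ.T X.carrier)) (x : X.carrier) :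
    Θ.xi (Θ.map (fun s => X.str s x) S) ≤ X.str (Θ.mu S) x := by
  have h := le_ext (Θ := Θ) X.str (Θ.map (fun s => (s, x)) S) (s := S) (t := Θ.e x)
    (by rw [TopTheory.map_map, TopTheory.map_id])
    (by rw [TopTheory.map_map]; exact map_const Θ x S)
  simp only [TopTheory.map_map] at h
  have h2 := (mul_le_mul' h (X.one_le x)).trans (X.trans S (Θ.e x) x)
  rwa [mul_one] at h2

theorem mStr_mul_le (X : TCat Θ) (s t : Θ.T X.carrier) (x : X.carrier) :
    mStr X.str s t * X.str t x ≤ X.str s x := by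
  rw [← Quantale.leftMulResiduation_le_iff_mul_le]
  refine iSup_le fun S => iSup_le fun hS => ?_
  subst hS
  rw [Quantale.leftMulResiduation_le_iff_mul_le]
  exact X.trans S t x

/-- The element `a(-, x)` of `X̂`. -/
def yonedaHat (X : TCat Θ) (x : X.carrier) : X.hat.carrier :=
  ⟨⟨fun s => X.str s x, (isTFunctor_free_iff _ _).2 fun S => X.ext_const_le S x⟩, by
    intro S s
    rw [homXi, Quantale.leftMulResiduation_le_iff_mul_le]
    refine ext_mul_le fun w hS hs => ?_
    have h1 : Θ.map (fun s => X.str s x) S = Θ.map (fun p => X.str p.1 x) w := by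
      rw [← hS]
      simp only [TopTheory.map_map]
    have h2 : X.str s x = Θ.xi (Θ.map (fun p => X.str p.2 x) w) := by
      rw [← Θ.xi_of_e (X.str s x), ← TopTheory.map_e Θ (fun s => X.str s x) s]
      refine congrArg Θ.xi ?_
      rw [show Θ.e s = _ from hs.symm]
      simp only [TopTheory.map_map]
    change _ ≤ X.str s x
    rw [h1, ← xi_mul', h2]
    exact Θ.xi_map_mono (fun p => X.mStr_mul_le p.2 p.1 x) w⟩

theorem tight_yonedaHat (X : TCat Θ) (x : X.carrier) : X.Tight (X.yonedaHat x) := by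
  have hE : ∀ t : Θ.T (E Θ).carrier, t = Θ.e PUnit.unit := fun t => Θ.obj_one _ _
  have hEE : ∀ t : Θ.T (Θ.T (E Θ).carrier), t = Θ.e (Θ.e PUnit.unit) := fun t => by
    have h := map_const Θ (Θ.e PUnit.unit : Θ.T (E Θ).carrier) t
    refine (TopTheory.map_id Θ t).symm.trans (Eq.trans ?_ h)
    exact congrArg (fun f => Θ.map f t) (funext hE)
  refine ⟨fun _ y => X.str (Θ.e x) y, ⟨?_, ?_⟩, ⟨?_, ?_⟩, ?_, ?_⟩
  · refine kleisli_le fun S t y => ?_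
    exact (mul_le_mul_left (ext_le fun w _ _ => by
      have h := Θ.xi_map_one (Θ.map (fun _ => PUnit.unit) w)
      rw [TopTheory.map_map] at h
      exact h.le) _).trans (one_mul _).le
  · refine kleisli_le fun S t y => ?_
    have h := ext_comap_le (Θ := Θ) (fun _ : Θ.T (E Θ).carrier => Θ.e x) (fun y => y) X.str S t
    rw [map_const Θ, TopTheory.map_id] at h
    refine (mul_le_mul_left h _).trans ((X.trans _ _ _).trans ?_)
    rw [TopTheory.mu_e]
  · refine kleisli_le fun S t y => ?_
    exact X.trans S t x
  · refine kleisli_le fun S t y => ?_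
    have h : Θ.ext (X.toRel (X.yonedaHat x)) S t ≤ X.str (Θ.mu S) x := by
      refine ext_le fun w hS _ => ?_
      refine le_trans (le_of_eq ?_) (X.ext_const_le S x)
      rw [← hS]
      simp only [TopTheory.map_map]
      rfl
    exact (mul_le_mul_left h _).trans (mul_one _).le
  · intro t y
    have h1 : (1 : V) ≤ Θ.ext (fun (_ : Θ.T (E Θ).carrier) y => X.str (Θ.e x) y)
        (Θ.e (Θ.e PUnit.unit)) (Θ.e x) :=
      (X.one_le x).trans (le_ext_e (fun (_ : Θ.T (E Θ).carrier) y => X.str (Θ.e x) y) _ x)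
    have h2 := mul_le_mul' h1 (X.one_le x)
    rw [mul_one] at h2
    refine h2.trans ?_
    refine le_iSup_of_le (Θ.e (Θ.e PUnit.unit)) (le_iSup_of_le ?_ (le_iSup_of_le (Θ.e x) le_rfl))
    rw [TopTheory.mu_e]
    exact (hE t).symm
  · refine kleisli_le fun S t y => ?_
    have h := ext_comap_le (Θ := Θ) (fun s : Θ.T X.carrier => s)
      (fun _ : (E Θ).carrier => x) X.str S t
    rw [map_const Θ, TopTheory.map_id] at h
    exact (mul_le_mul_left h _).trans (X.trans _ _ _)

/-- The Yoneda functor `y : X → X̃`, `x ↦ a(-, x)`. -/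
def yoneda (X : TCat Θ) : Hom X X.tilde where
  toFun x := ⟨X.yonedaHat x, X.tight_yonedaHat x⟩
  isTFunctor s x := by
    have hmap : Θ.map (fun ψ : X.hat.carrier => ψ.1) (Θ.map (fun ψ : X.tilde.carrier => ψ.1)
        (Θ.map (fun x => (⟨X.yonedaHat x, X.tight_yonedaHat x⟩ : X.tilde.carrier)) s)) =
        Θ.map (fun x => (X.yonedaHat x).1) s :=
      (congrArg _ (Θ.map_map _ _ s)).trans (Θ.map_map _ _ s)
    change X.str s x ≤ funStr (Θ.freeStr X.carrier) Θ.homXi (Θ.map (fun ψ : X.hat.carrier => ψ.1)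
      (Θ.map (fun ψ : X.tilde.carrier => ψ.1)
        (Θ.map (fun x => (⟨X.yonedaHat x, X.tight_yonedaHat x⟩ : X.tilde.carrier)) s)))
      (X.yonedaHat x).1
    rw [hmap, le_funStr_iff]
    intro q hq
    obtain ⟨r, hr1, hr2⟩ := Θ.exists_of_isPullbackSquare
      (p := fun z : Θ.T X.carrier × X.carrier => (z.1, (X.yonedaHat z.2).1)) (q := Prod.snd)
      (f := Prod.snd) (g := fun x => (X.yonedaHat x).1)
      ⟨fun _ => rfl, by
        rintro ⟨t, h⟩ y hy
        refine ⟨(t, y), ⟨Prod.ext rfl hy.symm, rfl⟩, ?_⟩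
        rintro ⟨t', y'⟩ ⟨h1, h2⟩
        exact Prod.ext (congrArg Prod.fst h1 :) h2⟩ q s hq
    have h1 : Θ.map Prod.fst q = Θ.map Prod.fst r := by
      rw [← hr1]
      simp only [TopTheory.map_map]
    have h2 : Θ.xi (Θ.map (fun z => z.2.1 z.1) q) ≤ Θ.ext X.str (Θ.map Prod.fst q) s := by
      have h := le_ext (Θ := Θ) X.str r h1.symm hr2
      refine le_trans (le_of_eq ?_) h
      rw [← hr1]
      simp only [TopTheory.map_map]
      rfl
    rw [mul_comm]
    exact (mul_le_mul_left h2 _).trans (X.trans _ s x)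

end TCat

/-!
The implications are obtained from the calculus of `T`-modules under Kleisli convolution.

Convolution is associative because `T_ξ` preserves composition of `V`-relations laxly
(`ext_mul_ext_le`) and `m` is compatible with it in both directions (`ext_ext_le`, which uses the
naturality of `ξ`, and `ext_mu_le`, which uses that the naturality squares of `m` are weak
pullbacks). Hence adjunctions of modules compose (`IsAdjunction.comp`), left adjoints are unique
(`IsAdjunction.left_unique`), and every `T`-functor `f` induces an adjunction `f_* ⊣ f^*`.

If `i : A → B` is fully faithful and L-dense, then `i^*` is also left adjoint to `i_*`. So for
`f : A → X` the modules `f_* ∘ i^* ⊣ i_* ∘ f^*` are adjoint, and if `X` is L-complete they are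
represented by an extension of `f` along `i`.

The Yoneda functor is itself fully faithful and L-dense, so L-injectivity extends the identity of
`X` along it. Full faithfulness is the Yoneda lemma `tilde_str_map_yoneda`: the structure of `X̃`
sends `(Ty(s), ψ)` to `ψ(s)`. For density, let `φ` be left adjoint to a tight `ψ`. Then
`1 ≤ ⨆ t, ξ(Tφ(t)) * ψ(t)`, and `φ(x)` is at most the structure of `X̃` at `(e(ψ), y(x))`, so
`φ` transports the value of the structure at `(p, ψ)` to the points `y(x)`; here `T1 = 1` makes
`ξ · T` commute with multiplication by a constant.

Finally, let `R` be a pseudo left inverse of `y`. Density gives `R^* = y_* ∘ y^* ∘ R^* = y_*`, that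
is, `R(ψ)` represents `ψ`. A right adjoint module `ψ : X ⇸ Z` is the same thing as a `T`-functor
`Z → X̃`, and its composite with `R` represents `ψ`.
-/

namespace TopTheory

variable {V : Type u} [CommMonoid V] [CompleteLattice V] [IsQuantale V] {Θ : TopTheory V}

/-! ### The extension of relations -/

/-- The naturality of `ξ`, in the form in which it bounds `ξ · Tψ` for a map `ψ` that is dominated
by the image of `φ` under `P_V f`. -/
theorem xi_map_le_of_le_iSup {X Y : Type u} (f : X → Y) (φ : X → V) (ψ : Y → V)
    (h : ∀ y, ψ y ≤ ⨆ x, ⨆ _ : f x = y, φ x) {s : Θ.T Y} {v : V}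
    (H : ∀ t, Θ.map f t = s → Θ.xi (Θ.map φ t) ≤ v) : Θ.xi (Θ.map ψ s) ≤ v :=
  (Θ.xi_map_mono h s).trans ((Θ.xi_natural f φ s).le.trans (iSup_le fun t => iSup_le (H t)))

theorem xi_map_const (Θ : TopTheory V) {X : Type u} (v : V) (t : Θ.T X) :
    Θ.xi (Θ.map (fun _ => v) t) = v := by
  rw [map_const, Θ.xi_of_e]

theorem ext_mono {X Y : Type u} {r r' : X → Y → V} (h : ∀ x y, r x y ≤ r' x y) (s : Θ.T X)
    (t : Θ.T Y) : Θ.ext r s t ≤ Θ.ext r' s t :=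
  ext_le fun w hs ht => (Θ.xi_map_mono (fun p => h p.1 p.2) w).trans (le_ext r' w hs ht)

theorem xi_map_le_ext {A X Y : Type u} (f : A → X) (g : A → Y) (r : X → Y → V) (w : Θ.T A) :
    Θ.xi (Θ.map (fun z => r (f z) (g z)) w) ≤ Θ.ext r (Θ.map f w) (Θ.map g w) := by
  have h := le_ext r (Θ.map (fun z => (f z, g z)) w) (TopTheory.map_map Θ _ _ w)
    (TopTheory.map_map Θ _ _ w)
  rwa [TopTheory.map_map] at h

theorem xi_map_left_le_ext {X Y : Type u} (r : X → Y → V) (s : Θ.T X) (y : Y) :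
    Θ.xi (Θ.map (fun x => r x y) s) ≤ Θ.ext r s (Θ.e y) := by
  have h := xi_map_le_ext (fun x => x) (fun _ => y) r s
  rwa [TopTheory.map_id, map_const] at h

theorem xi_map_right_le_ext {X Y : Type u} (r : X → Y → V) (x : X) (t : Θ.T Y) :
    Θ.xi (Θ.map (fun y => r x y) t) ≤ Θ.ext r (Θ.e x) t := by
  have h := xi_map_le_ext (fun _ => x) (fun y => y) r t
  rwa [TopTheory.map_id, map_const] at h

theorem ext_mul_ext_le {X Y Z : Type u} (r : X → Y → V) (r' : Y → Z → V) (c : X → Z → V)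
    (h : ∀ x y z, r x y * r' y z ≤ c x z) (s : Θ.T X) (t : Θ.T Y) (p : Θ.T Z) :
    Θ.ext r s t * Θ.ext r' t p ≤ Θ.ext c s p := by
  refine ext_mul_le fun w hs ht => ?_
  rw [mul_comm]
  refine ext_mul_le fun w' ht' hp => ?_
  obtain ⟨q, rfl, rfl⟩ := Θ.exists_of_isPullbackSquare
    (p := fun z : X × Y × Z => (z.1, z.2.1)) (q := Prod.snd) (f := Prod.snd) (g := Prod.fst)
    ⟨fun _ => rfl, by
      rintro ⟨x, y⟩ ⟨y', z⟩ (rfl : y = y')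
      exact ⟨(x, y, z), ⟨rfl, rfl⟩, fun q hq =>
        Prod.ext (congrArg Prod.fst hq.1 :) hq.2⟩⟩ w w' (ht.trans ht'.symm)
  rw [mul_comm, TopTheory.map_map, TopTheory.map_map, ← xi_mul']
  rw [TopTheory.map_map] at hs hp
  refine (Θ.xi_map_mono (fun z => h z.1 z.2.1 z.2.2) q).trans ?_
  refine (xi_map_le_ext (fun z : X × Y × Z => z.1) (fun z => z.2.2) c q).trans (le_of_eq ?_)
  rw [← hs, ← hp]

/-- `m` is a lax natural transformation `T_ξ T_ξ → T_ξ`. -/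
theorem ext_ext_le {X Y : Type u} (r : X → Y → V) (S : Θ.T (Θ.T X)) (S' : Θ.T (Θ.T Y)) :
    Θ.ext (Θ.ext r) S S' ≤ Θ.ext r (Θ.mu S) (Θ.mu S') := by
  refine ext_le fun w hS hS' => ?_
  refine xi_map_le_of_le_iSup
    (fun q : Θ.T (X × Y) => (Θ.map Prod.fst q, Θ.map Prod.snd q))
    (fun q => Θ.xi (Θ.map (fun p => r p.1 p.2) q)) _ ?_ ?_
  · rintro ⟨s, t⟩
    exact ext_le fun q hs ht => le_iSup_of_le q (le_iSup_of_le (Prod.ext hs ht) le_rfl)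
  · rintro W rfl
    rw [TopTheory.map_map] at hS hS'
    have h := Θ.xi_map_xi (Θ.map (Θ.map (fun p : X × Y => r p.1 p.2)) W)
    rw [TopTheory.map_map, ← TopTheory.map_mu] at h
    rw [h]
    refine le_ext r (Θ.mu W) ?_ ?_
    · rw [TopTheory.map_mu, ← hS]
    · rw [TopTheory.map_mu, ← hS']

/-- The strictness of `m`: `m° · T_ξ r ≤ T_ξ T_ξ r · m°`. -/
theorem ext_mu_le {X Y : Type u} (r : X → Y → V) (s : Θ.T X) (S' : Θ.T (Θ.T Y)) :
    Θ.ext r s (Θ.mu S') ≤ ⨆ S : Θ.T (Θ.T X), ⨆ _ : Θ.mu S = s, Θ.ext (Θ.ext r) S S' := by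
  refine ext_le fun w hs ht => ?_
  obtain ⟨W, rfl, rfl⟩ := Θ.exists_of_mu Prod.snd S' w ht.symm
  rw [TopTheory.map_mu] at hs
  refine le_iSup_of_le (Θ.map (Θ.map Prod.fst) W) (le_iSup_of_le hs ?_)
  rw [TopTheory.map_mu, ← Θ.xi_map_xi, TopTheory.map_map]
  refine le_trans ?_ (xi_map_le_ext (Θ.map Prod.fst) (Θ.map Prod.snd) (Θ.ext r) W)
  exact Θ.xi_map_mono (fun q => le_ext r q rfl rfl) W

/-! ### Kleisli convolution and modules -/

theorem le_kleisli {X Y Z : Type u} (b : Θ.TRel Y Z) (a : Θ.TRel X Y) (S : Θ.T (Θ.T X))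
    (t : Θ.T Y) (z : Z) : Θ.ext a S t * b t z ≤ kleisli b a (Θ.mu S) z :=
  le_iSup_of_le S (le_iSup_of_le rfl (le_iSup_of_le t le_rfl))

theorem kleisli_mono {X Y Z : Type u} {b b' : Θ.TRel Y Z} {a a' : Θ.TRel X Y} (hb : b ≤ b')
    (ha : a ≤ a') : kleisli b a ≤ kleisli b' a' :=
  kleisli_le fun S t z =>
    (mul_le_mul' (ext_mono ha S t) (hb t z)).trans (le_kleisli b' a' S t z)

theorem kleisli_kleisli_le {W X Y Z : Type u} (c : Θ.TRel Y Z) (b : Θ.TRel X Y)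
    (a : Θ.TRel W X) : kleisli c (kleisli b a) ≤ kleisli (kleisli c b) a := by
  refine kleisli_le fun S t z => ext_mul_le fun w hS ht => ?_
  rw [← Quantale.leftMulResiduation_le_iff_mul_le]
  refine xi_map_le_of_le_iSup
    (fun q : Θ.T (Θ.T W) × Θ.T X × Y => (Θ.mu q.1, q.2.2))
    (fun q => Θ.ext a q.1 q.2.1 * b q.2.1 q.2.2) _ ?_ ?_
  · rintro ⟨s, y⟩
    refine iSup_le fun S' => iSup_le fun hS' => iSup_le fun u => ?_
    exact le_iSup_of_le (S', u, y) (le_iSup_of_le (Prod.ext hS' rfl) le_rfl)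
  · rintro q rfl
    rw [Quantale.leftMulResiduation_le_iff_mul_le, xi_mul']
    rw [TopTheory.map_map] at hS ht
    have h1 := (xi_map_le_ext (fun q : Θ.T (Θ.T W) × Θ.T X × Y => q.1) (fun q => q.2.1)
      (Θ.ext a) q).trans (ext_ext_le a _ _)
    have h2 := xi_map_le_ext (fun q : Θ.T (Θ.T W) × Θ.T X × Y => q.2.1) (fun q => q.2.2) b q
    have hs : Θ.mu S = Θ.mu (Θ.mu (Θ.map Prod.fst q)) := by
      rw [← TopTheory.mu_mu, TopTheory.map_map, ← hS]
    rw [hs, mul_assoc]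
    refine (mul_le_mul' h1 ((mul_le_mul_left h2 _).trans ?_)).trans (le_kleisli _ a _ _ z)
    rw [ht]
    exact le_kleisli c b _ t z

theorem le_kleisli_kleisli {W X Y Z : Type u} (c : Θ.TRel Y Z) (b : Θ.TRel X Y)
    (a : Θ.TRel W X) : kleisli (kleisli c b) a ≤ kleisli c (kleisli b a) := by
  refine kleisli_le fun S t z => ?_
  rw [mul_comm, ← Quantale.leftMulResiduation_le_iff_mul_le]
  refine iSup_le fun S' => iSup_le fun hS' => iSup_le fun u => ?_
  subst hS'
  rw [Quantale.leftMulResiduation_le_iff_mul_le, mul_comm,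
    ← Quantale.leftMulResiduation_le_iff_mul_le]
  refine (ext_mu_le a S S').trans (iSup_le fun Q => iSup_le fun hQ => ?_)
  subst hQ
  rw [Quantale.leftMulResiduation_le_iff_mul_le, ← mul_assoc]
  have h := (ext_mul_ext_le (Θ.ext a) b (fun S y => kleisli b a (Θ.mu S) y)
    (fun S t y => le_kleisli b a S t y) Q S' u).trans
    (ext_comap_le Θ.mu (fun y => y) (kleisli b a) Q u)
  rw [TopTheory.map_id] at h
  refine (mul_le_mul_left h _).trans ((le_kleisli c _ _ u z).trans (le_of_eq ?_))
  rw [TopTheory.mu_mu]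

theorem kleisli_assoc {W X Y Z : Type u} (c : Θ.TRel Y Z) (b : Θ.TRel X Y)
    (a : Θ.TRel W X) : kleisli (kleisli c b) a = kleisli c (kleisli b a) :=
  le_antisymm (le_kleisli_kleisli c b a) (kleisli_kleisli_le c b a)

theorem kleisli_apply_mul_le {X Y : Type u} {a : Θ.TRel X X} {φ : Θ.TRel X Y}
    (h : kleisli φ a ≤ φ) (S : Θ.T (Θ.T X)) (t : Θ.T X) (y : Y) :
    Θ.ext a S t * φ t y ≤ φ (Θ.mu S) y :=
  (le_kleisli φ a S t y).trans (h _ _)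

theorem mStr_mul_le_of_kleisli_le {X Y : Type u} {a : Θ.TRel X X} {φ : Θ.TRel X Y}
    (h : kleisli φ a ≤ φ) (s t : Θ.T X) (y : Y) : mStr a s t * φ t y ≤ φ s y := by
  rw [← Quantale.leftMulResiduation_le_iff_mul_le]
  refine iSup_le fun S => iSup_le fun hS => ?_
  subst hS
  rw [Quantale.leftMulResiduation_le_iff_mul_le]
  exact kleisli_apply_mul_le h S t y

end TopTheory

namespace TCat

open TopTheory

variable {V : Type u} [CommMonoid V] [CompleteLattice V] [IsQuantale V] {Θ : TopTheory V}

theorem le_kleisli_str (X : TCat Θ) {Y : Type u} (φ : Θ.TRel X.carrier Y) :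
    φ ≤ kleisli φ X.str := by
  intro s y
  have h : 1 ≤ Θ.ext X.str (Θ.map Θ.e s) s := by
    have h1 := xi_map_le_ext Θ.e (fun x => x) X.str s
    rw [TopTheory.map_id] at h1
    exact (xi_map_const Θ 1 s).ge.trans ((Θ.xi_map_mono X.one_le s).trans h1)
  have h2 := (mul_le_mul_left h (φ s y)).trans (le_kleisli φ X.str _ s y)
  rwa [one_mul, TopTheory.mu_map_e] at h2

theorem le_str_kleisli (Y : TCat Θ) {X : Type u} (φ : Θ.TRel X Y.carrier) :
    φ ≤ kleisli Y.str φ := by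
  intro s y
  have h := (mul_le_mul' (le_ext_e φ s y) (Y.one_le y)).trans (le_kleisli Y.str φ _ _ y)
  rwa [mul_one, TopTheory.mu_e] at h

theorem kleisli_str {X : TCat Θ} {Y : Type u} {φ : Θ.TRel X.carrier Y}
    (h : kleisli φ X.str ≤ φ) : kleisli φ X.str = φ :=
  le_antisymm h (X.le_kleisli_str φ)

theorem str_kleisli {Y : TCat Θ} {X : Type u} {φ : Θ.TRel X Y.carrier}
    (h : kleisli Y.str φ ≤ φ) : kleisli Y.str φ = φ :=
  le_antisymm h (Y.le_str_kleisli φ)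

theorem kleisli_str_str_le (X : TCat Θ) : kleisli X.str X.str ≤ X.str :=
  kleisli_le X.trans

/-! ### Adjunctions of modules -/

theorem isTModule_comp {X Y Z : TCat Θ} {φ : Θ.TRel X.carrier Y.carrier}
    {ψ : Θ.TRel Y.carrier Z.carrier} (hφ : IsTModule X.str Y.str φ)
    (hψ : IsTModule Y.str Z.str ψ) : IsTModule X.str Z.str (kleisli ψ φ) := by
  refine ⟨?_, ?_⟩
  · rw [kleisli_assoc]
    exact kleisli_mono le_rfl hφ.1
  · rw [← kleisli_assoc]
    exact kleisli_mono hψ.2 le_rfl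

theorem IsAdjunction.isTModule_right {X Y : TCat Θ} {φ : Θ.TRel X.carrier Y.carrier}
    {ψ : Θ.TRel Y.carrier X.carrier} (h : IsAdjunction X.str Y.str φ ψ) :
    IsTModule Y.str X.str ψ :=
  h.2.1

theorem IsAdjunction.comp {X Y Z : TCat Θ} {φ : Θ.TRel X.carrier Y.carrier}
    {ψ : Θ.TRel Y.carrier X.carrier} {φ' : Θ.TRel Y.carrier Z.carrier}
    {ψ' : Θ.TRel Z.carrier Y.carrier} (h : IsAdjunction X.str Y.str φ ψ)
    (h' : IsAdjunction Y.str Z.str φ' ψ') :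
    IsAdjunction X.str Z.str (kleisli φ' φ) (kleisli ψ ψ') := by
  refine ⟨isTModule_comp h.1 h'.1, isTModule_comp h'.2.1 h.2.1, ?_, ?_⟩
  · calc X.str ≤ kleisli ψ φ := h.2.2.1
      _ = kleisli ψ (kleisli Y.str φ) := by rw [str_kleisli h.1.2]
      _ ≤ kleisli ψ (kleisli (kleisli ψ' φ') φ) :=
        kleisli_mono le_rfl (kleisli_mono h'.2.2.1 le_rfl)
      _ = kleisli (kleisli ψ ψ') (kleisli φ' φ) := by simp only [kleisli_assoc]
  · calc kleisli (kleisli φ' φ) (kleisli ψ ψ')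
        = kleisli φ' (kleisli (kleisli φ ψ) ψ') := by simp only [kleisli_assoc]
      _ ≤ kleisli φ' (kleisli Y.str ψ') := kleisli_mono le_rfl (kleisli_mono h.2.2.2 le_rfl)
      _ = kleisli φ' ψ' := by rw [str_kleisli h'.2.1.2]
      _ ≤ Z.str := h'.2.2.2

theorem IsAdjunction.left_le {X Y : TCat Θ} {φ φ' : Θ.TRel X.carrier Y.carrier}
    {ψ : Θ.TRel Y.carrier X.carrier} (h : IsAdjunction X.str Y.str φ ψ)
    (h' : IsAdjunction X.str Y.str φ' ψ) : φ ≤ φ' :=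
  calc φ ≤ kleisli φ X.str := X.le_kleisli_str φ
    _ ≤ kleisli φ (kleisli ψ φ') := kleisli_mono le_rfl h'.2.2.1
    _ = kleisli (kleisli φ ψ) φ' := (kleisli_assoc _ _ _).symm
    _ ≤ kleisli Y.str φ' := kleisli_mono h.2.2.2 le_rfl
    _ ≤ φ' := h'.1.2

theorem IsAdjunction.left_unique {X Y : TCat Θ} {φ φ' : Θ.TRel X.carrier Y.carrier}
    {ψ : Θ.TRel Y.carrier X.carrier} (h : IsAdjunction X.str Y.str φ ψ)
    (h' : IsAdjunction X.str Y.str φ' ψ) : φ = φ' :=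
  le_antisymm (IsAdjunction.left_le h h') (IsAdjunction.left_le h' h)

namespace Hom

theorem kleisli_upper {X Y : TCat Θ} (f : Hom X Y) {Z : Type u} (φ : Θ.TRel Z Y.carrier) :
    kleisli f.upper φ = fun s x => kleisli Y.str φ s (f.toFun x) := rfl

theorem ext_lower_le {X Y : TCat Θ} (f : Hom X Y) (S : Θ.T (Θ.T X.carrier))
    (t : Θ.T Y.carrier) : Θ.ext f.lower S t ≤ Θ.ext Y.str (Θ.map (Θ.map f.toFun) S) t := by
  have h := ext_comap_le (Θ.map f.toFun) (fun y => y) Y.str S t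
  rwa [TopTheory.map_id] at h

theorem ext_str_le {X Y : TCat Θ} (f : Hom X Y) (S : Θ.T (Θ.T X.carrier)) (s : Θ.T X.carrier) :
    Θ.ext X.str S s ≤ Θ.ext Y.str (Θ.map (Θ.map f.toFun) S) (Θ.map f.toFun s) :=
  (ext_mono f.isTFunctor S s).trans (ext_comap_le (Θ.map f.toFun) f.toFun Y.str S s)

theorem isTModule_lower {X Y : TCat Θ} (f : Hom X Y) : IsTModule X.str Y.str f.lower := by
  refine ⟨kleisli_le fun S t y => ?_, kleisli_le fun S t y => ?_⟩
  · refine (mul_le_mul_left (f.ext_str_le S t) _).trans ((Y.trans _ _ y).trans (le_of_eq ?_))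
    rw [lower, TopTheory.map_mu]
  · refine (mul_le_mul_left (f.ext_lower_le S t) _).trans ((Y.trans _ _ y).trans (le_of_eq ?_))
    rw [lower, TopTheory.map_mu]

theorem isTModule_upper {X Y : TCat Θ} (f : Hom X Y) : IsTModule Y.str X.str f.upper := by
  refine ⟨kleisli_le fun S t x => Y.trans S t _, kleisli_le fun S t x => ?_⟩
  have h := ext_comap_le (fun s => s) f.toFun Y.str S t
  rw [TopTheory.map_id] at h
  exact (mul_le_mul' h (f.isTFunctor t x)).trans (Y.trans _ _ _)

theorem isAdjunction {X Y : TCat Θ} (f : Hom X Y) :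
    IsAdjunction X.str Y.str f.lower f.upper := by
  refine ⟨f.isTModule_lower, f.isTModule_upper, ?_, ?_⟩
  · rw [kleisli_upper, str_kleisli f.isTModule_lower.2]
    exact f.isTFunctor
  · refine kleisli_le fun S t y => ?_
    have h := ext_comap_le (fun s => s) f.toFun Y.str S t
    rw [TopTheory.map_id] at h
    exact (mul_le_mul_left h _).trans (Y.trans _ _ y)

theorem FullyFaithful.kleisli_upper_lower {X Y : TCat Θ} {f : Hom X Y} (h : f.FullyFaithful) :
    kleisli f.upper f.lower = X.str := by
  rw [kleisli_upper, str_kleisli f.isTModule_lower.2]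
  exact (funext fun s => funext fun x => h s x).symm

/-- Along a fully faithful L-dense functor the two induced modules are mutually inverse, so the
adjunction `i_* ⊣ i^*` can be reversed. -/
theorem isAdjunction_upper_lower {X Y : TCat Θ} {i : Hom X Y} (hi : i.FullyFaithful)
    (hi' : i.LDense) : IsAdjunction Y.str X.str i.upper i.lower :=
  ⟨i.isTModule_upper, i.isTModule_lower, hi'.ge, hi.kleisli_upper_lower.le⟩

end Hom

theorem LComplete.lInjective {X : TCat Θ} (hX : X.LComplete) : X.LInjective := by
  intro A B i hi hi' f
  obtain ⟨g, -, hg⟩ :=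
    hX B _ _ (IsAdjunction.comp (Hom.isAdjunction_upper_lower hi hi') f.isAdjunction)
  have h : (g.comp i).upper = f.upper :=
    calc (g.comp i).upper = kleisli i.upper g.upper := by
          rw [Hom.kleisli_upper, str_kleisli g.isTModule_upper.2]
          rfl
      _ = kleisli (kleisli i.upper i.lower) f.upper := by rw [← hg, kleisli_assoc]
      _ = f.upper := by rw [hi.kleisli_upper_lower, str_kleisli f.isTModule_upper.2]
  exact ⟨g, h.le, h.ge⟩

/-! ### The Yoneda lemma -/

/-- The structure of `X̃` unfolded as that of the exponential `|X| ⊸ V`. -/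
theorem le_tilde_str_iff (X : TCat Θ) (v : V) {A : Type u} (f : A → X.tilde.carrier) (p : Θ.T A)
    (ψ : X.tilde.carrier) : v ≤ X.tilde.str (Θ.map f p) ψ ↔
      ∀ q : Θ.T (Θ.T X.carrier × A),
        Θ.map Prod.snd q = p → v * Θ.xi (Θ.map (fun z => (f z.2).1.1.1 z.1) q) ≤
          ψ.1.1.1 (Θ.mu (Θ.map Prod.fst q)) := by
  have hp : Θ.map (fun ψ : X.hat.carrier => ψ.1) (Θ.map (fun ψ : X.tilde.carrier => ψ.1)
      (Θ.map f p)) = Θ.map (fun x => (f x).1.1) p :=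
    (congrArg _ (Θ.map_map _ _ p)).trans (Θ.map_map _ _ p)
  change v ≤ funStr (Θ.freeStr X.carrier) Θ.homXi (Θ.map (fun ψ : X.hat.carrier => ψ.1)
      (Θ.map (fun ψ : X.tilde.carrier => ψ.1) (Θ.map f p))) ψ.1.1 ↔ _
  rw [hp, le_funStr_iff]
  constructor
  · intro H q hq
    have h := H (Θ.map (fun z => (z.1, (f z.2).1.1)) q) (by
      rw [← hq, TopTheory.map_map, TopTheory.map_map])
    rwa [TopTheory.map_map, TopTheory.map_map] at h
  · intro H q hq
    obtain ⟨r, rfl, hr⟩ := Θ.exists_of_isPullbackSquare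
      (p := fun z : Θ.T X.carrier × A => (z.1, (f z.2).1.1)) (q := Prod.snd)
      (f := Prod.snd) (g := fun x => (f x).1.1)
      ⟨fun _ => rfl, by
        rintro ⟨t, h⟩ y hy
        refine ⟨(t, y), ⟨Prod.ext rfl hy.symm, rfl⟩, ?_⟩
        rintro ⟨t', y'⟩ ⟨h1, h2⟩
        exact Prod.ext (congrArg Prod.fst h1 :) h2⟩ q p hq
    rw [TopTheory.map_map, TopTheory.map_map]
    exact H r hr

/-- For `ψ` in `X̂` the inequality `ψ ∘ a ≤ ψ` holds because `ψ` is a `T`-functor on `X^op`. -/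
theorem ext_mul_hat_le (X : TCat Θ) (ψ : X.hat.carrier) (S : Θ.T (Θ.T X.carrier))
    (t : Θ.T X.carrier) : Θ.ext X.str S t * ψ.1.1 t ≤ ψ.1.1 (Θ.mu S) := by
  have h := ψ.2 (Θ.e t) (Θ.mu S)
  rw [homXi, Quantale.leftMulResiduation_le_iff_mul_le, TopTheory.map_e, Θ.xi_of_e] at h
  refine (mul_le_mul_left ?_ _).trans h
  refine le_trans ?_ (le_ext_e (fun t t' => mStr X.str t' t) t (Θ.mu S))
  exact le_iSup_of_le S (le_iSup_of_le rfl le_rfl)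

/-- The Yoneda lemma. -/
theorem tilde_str_map_yoneda (X : TCat Θ) (s : Θ.T X.carrier) (ψ : X.tilde.carrier) :
    X.tilde.str (Θ.map X.yoneda.toFun s) ψ = ψ.1.1.1 s := by
  refine le_antisymm ?_ ?_
  · -- Evaluate the infimum defining the structure at `T⟨e, 1⟩(s)`.
    have h := (X.le_tilde_str_iff _ X.yoneda.toFun s ψ).1 le_rfl
      (Θ.map (fun x => (Θ.e x, x)) s) (by rw [TopTheory.map_map, TopTheory.map_id])
    rw [TopTheory.map_map, TopTheory.map_map, TopTheory.mu_map_e] at h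
    refine le_trans ?_ h
    refine (mul_one _).ge.trans (mul_le_mul_right ?_ _)
    exact (xi_map_const Θ 1 s).ge.trans (Θ.xi_map_mono X.one_le s)
  · rw [le_tilde_str_iff]
    rintro q rfl
    rw [mul_comm]
    have h : Θ.xi (Θ.map (fun z => X.str z.1 z.2) q) ≤ _ :=
      xi_map_le_ext (fun z : Θ.T X.carrier × X.carrier => z.1) (fun z => z.2) X.str q
    exact (mul_le_mul_left h _).trans (X.ext_mul_hat_le ψ.1 _ _)

theorem lower_yoneda (X : TCat Θ) : X.yoneda.lower = fun s ψ => ψ.1.1.1 s :=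
  funext fun s => funext fun ψ => X.tilde_str_map_yoneda s ψ

theorem fullyFaithful_yoneda (X : TCat Θ) : X.yoneda.FullyFaithful :=
  fun s x => (X.tilde_str_map_yoneda s (X.yoneda.toFun x)).symm

/-! ### Density of the Yoneda functor -/

/-- The left adjoint of `ψ` is bounded by the structure of `X̃` at `(e(ψ), y(x))`. -/
theorem left_adjoint_le_str (X : TCat Θ) (ψ : X.tilde.carrier)
    {φ : Θ.TRel (E Θ).carrier X.carrier}
    (h : IsAdjunction (E Θ).str X.str φ (X.toRel ψ.1)) (x : X.carrier) :
    φ (Θ.e PUnit.unit) x ≤ X.tilde.str (Θ.e ψ) (X.yoneda.toFun x) := by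
  rw [← TopTheory.map_id Θ (Θ.e ψ), le_tilde_str_iff]
  intro q hq
  obtain ⟨S, rfl, -⟩ := Θ.exists_of_isPullbackSquare
    (p := fun s : Θ.T X.carrier => (s, ψ)) (q := fun _ => PUnit.unit.{u + 1}) (f := Prod.snd)
    (g := fun _ => ψ) ⟨fun _ => rfl, by
      rintro ⟨s, ψ'⟩ _ (rfl : ψ' = ψ)
      exact ⟨s, ⟨rfl, rfl⟩, fun y hy => congrArg Prod.fst hy.1⟩⟩ q (Θ.e PUnit.unit)
    (by rw [hq, TopTheory.map_e])
  rw [TopTheory.map_map, TopTheory.map_map, TopTheory.map_id, mul_comm]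
  refine (mul_le_mul_left (xi_map_left_le_ext (X.toRel ψ.1) S PUnit.unit) _).trans ?_
  exact (le_kleisli φ (X.toRel ψ.1) S _ x).trans (h.2.2.2 _ x)

/-- The unit of an adjunction `φ ⊣ ψ` with domain `E`; since `T1 = 1`, the relation `φ` amounts
to a map `X → V`. -/
theorem one_le_iSup_of_isAdjunction (X : TCat Θ) {φ : Θ.TRel (E Θ).carrier X.carrier}
    {ψ : Θ.TRel X.carrier (E Θ).carrier} (h : IsAdjunction (E Θ).str X.str φ ψ) :
    1 ≤ ⨆ t, Θ.xi (Θ.map (φ (Θ.e PUnit.unit)) t) * ψ t PUnit.unit := by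
  refine (h.2.2.1 (Θ.e PUnit.unit) PUnit.unit).trans ?_
  refine iSup_le fun S => iSup_le fun _ => iSup_le fun t => le_iSup_of_le t ?_
  refine mul_le_mul_left (ext_le fun w _ ht => le_of_eq ?_) _
  rw [← ht, TopTheory.map_map]
  refine congrArg (fun f => Θ.xi (Θ.map f w)) (funext fun p => ?_)
  exact congrArg (fun s => φ s p.2) (Θ.obj_one p.1 _)

theorem lDense_yoneda (X : TCat Θ) : X.yoneda.LDense := by
  refine le_antisymm X.yoneda.isAdjunction.2.2.2 fun p ψ => ?_
  obtain ⟨φ, h⟩ := ψ.2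
  have h1 := mul_le_mul_right (X.one_le_iSup_of_isAdjunction h) (X.tilde.str p ψ)
  rw [mul_one, Quantale.mul_iSup_distrib] at h1
  refine h1.trans (iSup_le fun t => ?_)
  -- The supremum defining the convolution is bounded below by its term at `e(p)`.
  have h2 := le_kleisli X.yoneda.lower X.yoneda.upper (Θ.e p) t ψ
  rw [TopTheory.mu_e, lower_yoneda] at h2
  refine le_trans ?_ (h2.trans (by rw [lower_yoneda]))
  rw [← mul_assoc]
  refine mul_le_mul_left (le_trans ?_ (xi_map_right_le_ext X.yoneda.upper p t)) _
  rw [← xi_map_const Θ (X.tilde.str p ψ) t, ← xi_mul']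
  refine Θ.xi_map_mono (fun x => ?_) t
  refine (mul_le_mul' ?_ (X.left_adjoint_le_str ψ h x)).trans
    (kleisli_apply_mul_le X.tilde.kleisli_str_str_le (Θ.e p) (Θ.e ψ) _ |>.trans ?_)
  · exact le_ext_e X.tilde.str p ψ
  · rw [TopTheory.mu_e]
    rfl

/-- A pseudo left inverse of the Yoneda functor represents the elements of `X̃`. -/
theorem upper_of_comp_yoneda_equivalent {X : TCat Θ} {R : Hom X.tilde X}
    (hR : (R.comp X.yoneda).Equivalent (Hom.id X)) : R.upper = X.yoneda.lower :=
  calc R.upper = kleisli (kleisli X.yoneda.lower X.yoneda.upper) R.upper := by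
        rw [show kleisli X.yoneda.lower X.yoneda.upper = _ from X.lDense_yoneda,
          str_kleisli R.isTModule_upper.2]
    _ = kleisli X.yoneda.lower (R.comp X.yoneda).upper := by
        rw [kleisli_assoc, Hom.kleisli_upper, str_kleisli R.isTModule_upper.2]
        rfl
    _ = kleisli X.yoneda.lower X.str := by
        rw [show (R.comp X.yoneda).upper = X.str from le_antisymm hR.1 hR.2]
    _ = X.yoneda.lower := kleisli_str X.yoneda.isTModule_lower.1

/-! ### Right adjoint modules as functors into `X̃` -/

/-- The `T`-functor `E → Z` with value `z`. -/
def point (Z : TCat Θ) (z : Z.carrier) : Hom (E Θ) Z where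
  toFun _ := z
  isTFunctor s _ := by
    rw [TopTheory.map_const]
    exact Z.one_le z

/-- The element `ψ(-, z)` of `X̂`, for a module `ψ : X ⇸ Z`. -/
def fiberHat {X Z : TCat Θ} {ψ : Θ.TRel X.carrier Z.carrier} (h : IsTModule X.str Z.str ψ)
    (z : Z.carrier) : X.hat.carrier :=
  ⟨⟨fun s => ψ s z, (isTFunctor_free_iff _ _).2 fun S => by
    have h1 := mul_le_mul' (xi_map_left_le_ext ψ S z) (Z.one_le z)
    rw [mul_one] at h1
    exact h1.trans ((le_kleisli Z.str ψ S _ z).trans (h.2 _ z))⟩, by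
    intro S s
    rw [homXi, Quantale.leftMulResiduation_le_iff_mul_le]
    refine ext_mul_le fun w hS hs => ?_
    have h1 : ψ s z = Θ.xi (Θ.map (fun p => ψ p.2 z) w) := by
      rw [← Θ.xi_of_e (ψ s z), ← TopTheory.map_e Θ (fun s => ψ s z) s, ← hs, TopTheory.map_map]
    change _ ≤ ψ s z
    rw [← hS, TopTheory.map_map, ← xi_mul', h1]
    exact Θ.xi_map_mono (fun p => mStr_mul_le_of_kleisli_le h.1 p.2 p.1 z) w⟩

theorem tight_fiberHat {X Z : TCat Θ} {φ : Θ.TRel Z.carrier X.carrier}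
    {ψ : Θ.TRel X.carrier Z.carrier} (h : IsAdjunction Z.str X.str φ ψ) (z : Z.carrier) :
    X.Tight (fiberHat (IsAdjunction.isTModule_right h) z) := by
  have h1 := IsAdjunction.comp (Z.point z).isAdjunction h
  have h2 : kleisli (Z.point z).upper ψ = X.toRel (fiberHat (IsAdjunction.isTModule_right h) z) := by
    rw [Hom.kleisli_upper, str_kleisli h.2.1.2]
    rfl
  rw [h2] at h1
  exact ⟨_, h1⟩

/-- The `T`-functor `Z → X̃`, `z ↦ ψ(-, z)`, for a right adjoint module `ψ : X ⇸ Z`. -/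
def nameHom {X Z : TCat Θ} {φ : Θ.TRel Z.carrier X.carrier}
    {ψ : Θ.TRel X.carrier Z.carrier} (h : IsAdjunction Z.str X.str φ ψ) : Hom Z X.tilde where
  toFun z := ⟨fiberHat (IsAdjunction.isTModule_right h) z, tight_fiberHat h z⟩
  isTFunctor t z := by
    refine (X.le_tilde_str_iff _ _ t _).2 ?_
    rintro q rfl
    rw [mul_comm]
    have h1 := xi_map_le_ext (fun z : Θ.T X.carrier × Z.carrier => z.1) (fun z => z.2) ψ q
    refine (mul_le_mul_left h1 _).trans ?_
    exact (le_kleisli Z.str ψ _ _ z).trans (h.2.1.2 _ z)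

theorem lComplete_of_comp_yoneda_equivalent {X : TCat Θ} {R : Hom X.tilde X}
    (hR : (R.comp X.yoneda).Equivalent (Hom.id X)) : X.LComplete := by
  intro Z φ ψ h
  have hψ : (R.comp (nameHom h)).upper = ψ := by
    funext s z
    have h1 := congrFun (congrFun (upper_of_comp_yoneda_equivalent hR) s) ((nameHom h).toFun z)
    rw [lower_yoneda] at h1
    exact h1
  have h2 := (R.comp (nameHom h)).isAdjunction
  rw [hψ] at h2
  exact ⟨_, IsAdjunction.left_unique h h2, hψ.symm⟩

end TCat

theorem mainTheorem2 {V : Type u} [CommMonoid V] [CompleteLattice V] [IsQuantale V]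
    (Θ : TopTheory V) (X : TCat Θ) :
    List.TFAE [
      X.LComplete,
      X.LInjective,
      ∃ R : TCat.Hom X.tilde X, (R.comp X.yoneda).Equivalent (TCat.Hom.id X)] := by
  tfae_have 1 → 2 := TCat.LComplete.lInjective
  tfae_have 2 → 3 := fun h =>
    h X X.tilde X.yoneda X.fullyFaithful_yoneda X.lDense_yoneda (TCat.Hom.id X)
  tfae_have 3 → 1 := fun ⟨_, hR⟩ => TCat.lComplete_of_comp_yoneda_equivalent hR
  tfae_finish
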